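/- Let $X$ be a finite set and let $(X,\{R_i\}_{i=0}^3)$ be a symmetric association scheme with $3$ classes, i.e. $R_0,\dots,R_3$ are nonempty symmetric relations partitioning $X\times X$, $R_0$ is the identity relation, and for all $i,j,k$ and $(x,y)\in R_k$ the number of $z$ with $(x,z)\in R_i$, $(z,y)\in R_j$ depends only on $i,j,k$. Let $E_0=\frac1{|X|}J,E_1,E_2,E_3$ be an ordering of the primitive idempotents of its Bose--Mesner algebra, and define the Krein numbers $q_{ij}^k$ by $E_i\circ E_j=\frac1{|X|}\sum_{k=0}^3 q_{ij}^kE_k$, where $\circ$ is the entrywise product. Put $a_i^*=q_{1,i}^i$, $b_i^*=q_{1,i+1}^i$ ($i<3$), $c_i^*=q_{1,i-1}^i$ ($i>0$), $b_3^*=c_0^*=0$. Assume that the scheme is $Q$-polynomial with respect to this ordering, i.e. for each $i$ there is a polynomial $v_i^*$ of degree $i$ such that $|X|E_i=v_i^*(|X|E_1)$ entrywise. Assume further that it is $Q$-antipodal with equivalence relation $R_0\cup R_2$, i.e. $b_j^*=c_{3-j}^*$ for all $j\in\{0,1,2,3\}$ with $j\neq1$, $R_0\cup R_2$ is an equivalence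 relation, and its adjacency matrix is a scalar multiple of $E_0+E_3$. Then the following are equivalent. 1. The scheme is triply regular: for all $i,j,k,l,m,n\in\{0,1,2,3\}$ and all $x,y,z\in X$ with $(x,y)\in R_i$, $(y,z)\in R_j$, $(z,x)\in R_k$, the number $|\{w\in X:(x,w)\in R_l,\ (y,w)\in R_m,\ (z,w)\in R_n\}|$ depends only on $i,j,k,l,m,n$ and not on $x,y,z$. 2. $a_1^*=0$. -/

import Mathlib

open scoped Matrix

/-- A symmetric association scheme with `d` classes on a finite set `X`.  The partition of
`X × X` into the `d + 1` nonempty relations `R₀, …, R_d` is recorded by the map sending `(x, y)`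
to the index `rel x y` of the unique relation that contains it. -/
structure AssocScheme (X : Type*) [Fintype X] (d : ℕ) where
  rel : X → X → Fin (d + 1)
  rel_nonempty : ∀ i, ∃ x y, rel x y = i
  rel_eq_zero_iff : ∀ x y, rel x y = 0 ↔ x = y
  rel_symm : ∀ x y, rel x y = rel y x
  exists_intersection_number : ∀ i j k, ∃ p : ℕ, ∀ x y, rel x y = k →
    (Finset.univ.filter fun z => rel x z = i ∧ rel z y = j).card = p

namespace AssocScheme

variable {X : Type*} [Fintype X] {d : ℕ}

/-- The adjacency matrix of the relation `R_i`. -/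
def adj (S : AssocScheme X d) (i : Fin (d + 1)) : Matrix X X ℝ :=
  Matrix.of fun x y => if S.rel x y = i then 1 else 0

/-- The Bose–Mesner algebra, as the real span of the adjacency matrices. -/
def boseMesner (S : AssocScheme X d) : Submodule ℝ (Matrix X X ℝ) :=
  Submodule.span ℝ (Set.range S.adj)

/-- `E₀, …, E_d` is an ordering of the primitive idempotents of the Bose–Mesner algebra, with
`E₀ = |X|⁻¹ J`.  (The algebra has dimension `d + 1`, so `d + 1` nonzero pairwise orthogonal
idempotents in it are exactly its primitive idempotents.) -/
structure IsPrimitiveIdempotents [DecidableEq X] (S : AssocScheme X d)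
    (E : Fin (d + 1) → Matrix X X ℝ) : Prop where
  mem : ∀ i, E i ∈ S.boseMesner
  ne_zero : ∀ i, E i ≠ 0
  mul_self : ∀ i, E i * E i = E i
  mul_ne : ∀ i j, i ≠ j → E i * E j = 0
  sum_eq_one : ∑ i, E i = 1
  zero_eq : E 0 = (Fintype.card X : ℝ)⁻¹ • Matrix.of fun _ _ => 1

/-- The Krein number `q_{ij}^k`, that is, the coefficient in
`E_i ∘ E_j = |X|⁻¹ ∑ k, q_{ij}^k E_k` (entrywise product); see `hadamard_eq_sum_krein`. -/
noncomputable def krein (E : Fin (d + 1) → Matrix X X ℝ) (i j k : Fin (d + 1)) : ℝ :=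
  Fintype.card X * ((E i ⊙ E j) * E k).trace / (E k).trace

/-- `a_i^* = q_{1,i}^i`. -/
noncomputable def aStar (E : Fin (d + 1) → Matrix X X ℝ) (i : Fin (d + 1)) : ℝ :=
  krein E 1 i i

/-- `b_i^* = q_{1,i+1}^i` for `i < d`, and `b_d^* = 0`. -/
noncomputable def bStar (E : Fin (d + 1) → Matrix X X ℝ) (i : Fin (d + 1)) : ℝ :=
  if h : (i : ℕ) < d then krein E 1 ⟨i + 1, by omega⟩ i else 0

/-- `c_i^* = q_{1,i-1}^i` for `0 < i`, and `c_0^* = 0`. -/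
noncomputable def cStar (E : Fin (d + 1) → Matrix X X ℝ) (i : Fin (d + 1)) : ℝ :=
  if 0 < (i : ℕ) then krein E 1 ⟨i - 1, by omega⟩ i else 0

/-- The scheme is `Q`-polynomial with respect to the ordering `E₀, …, E_d` of its primitive
idempotents: for each `i` there is a polynomial `v_i^*` of degree `i` such that
`|X| E_i = v_i^*(|X| E_1)`, applied entrywise. -/
def IsQPolynomial [DecidableEq X] (S : AssocScheme X d)
    (E : Fin (d + 1) → Matrix X X ℝ) : Prop :=
  S.IsPrimitiveIdempotents E ∧
    ∀ i : Fin (d + 1), ∃ p : Polynomial ℝ, p.degree = ((i : ℕ) : WithBot ℕ) ∧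
      ∀ x y, (Fintype.card X : ℝ) * E i x y = p.eval ((Fintype.card X : ℝ) * E 1 x y)

/-- The `Q`-antipodality condition on the dual intersection array: `b_j^* = c_{d-j}^*` for all
`j` except possibly `j = ⌊d/2⌋`. -/
def IsQAntipodal (E : Fin (d + 1) → Matrix X X ℝ) : Prop :=
  ∀ j : Fin (d + 1), (j : ℕ) ≠ d / 2 → bStar E j = cStar E j.rev

/-- `⋃ i ∈ I, R_i` is the equivalence relation belonging to `Q`-antipodality: it is an
equivalence relation, and its matrix is a multiple of `E_0 + E_d`. -/
def IsQAntipodalRelation (S : AssocScheme X d) (E : Fin (d + 1) → Matrix X X ℝ)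
    (I : Finset (Fin (d + 1))) : Prop :=
  Equivalence (fun x y => S.rel x y ∈ I) ∧
    ∃ c : ℝ, ∑ i ∈ I, S.adj i = c • (E 0 + E (Fin.last d))

/-- Triple regularity: for `(x, y) ∈ R_i`, `(y, z) ∈ R_j`, `(z, x) ∈ R_k`, the number
`|R_l(x) ∩ R_m(y) ∩ R_n(z)|` depends only on `i, j, k, l, m, n`. -/
def IsTriplyRegular (S : AssocScheme X d) : Prop :=
  ∀ i j k l m n : Fin (d + 1), ∃ p : ℕ, ∀ x y z : X,
    S.rel x y = i → S.rel y z = j → S.rel z x = k →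
      (Finset.univ.filter fun w => S.rel x w = l ∧ S.rel y w = m ∧ S.rel z w = n).card = p

theorem hadamard_mem_boseMesner (S : AssocScheme X d) {M N : Matrix X X ℝ}
    (hM : M ∈ S.boseMesner) (hN : N ∈ S.boseMesner) : M ⊙ N ∈ S.boseMesner := by
  unfold boseMesner at hM hN
  induction hM using Submodule.span_induction with
  | mem M h =>
    obtain ⟨i, rfl⟩ := h
    induction hN using Submodule.span_induction with
    | mem N h =>
      obtain ⟨j, rfl⟩ := h
      by_cases hij : i = j
      · subst hij
        have : S.adj i ⊙ S.adj i = S.adj i := by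
          ext x y; simp [adj, Matrix.hadamard]
        rw [this]
        exact Submodule.subset_span ⟨i, rfl⟩
      · have : S.adj i ⊙ S.adj j = 0 := by
          ext x y
          simp only [adj, Matrix.hadamard, Matrix.of_apply, Matrix.zero_apply]
          split_ifs <;> simp_all
        rw [this]
        exact Submodule.zero_mem _
    | zero => simp
    | add M N _ _ h1 h2 => rw [Matrix.hadamard_add]; exact Submodule.add_mem _ h1 h2
    | smul c M _ h => rw [Matrix.hadamard_smul]; exact Submodule.smul_mem _ _ h
  | zero => simp
  | add M N _ _ h1 h2 => rw [Matrix.add_hadamard]; exact Submodule.add_mem _ h1 h2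
  | smul c M _ h => rw [Matrix.smul_hadamard]; exact Submodule.smul_mem _ _ h

theorem IsPrimitiveIdempotents.sum_smul_mul [DecidableEq X] {S : AssocScheme X d}
    {E : Fin (d + 1) → Matrix X X ℝ} (hE : S.IsPrimitiveIdempotents E)
    (g : Fin (d + 1) → ℝ) (k : Fin (d + 1)) : (∑ i, g i • E i) * E k = g k • E k := by
  rw [Finset.sum_mul, Finset.sum_eq_single k]
  · rw [smul_mul_assoc, hE.mul_self]
  · intro i _ hi
    rw [smul_mul_assoc, hE.mul_ne i k hi, smul_zero]
  · simp

theorem IsPrimitiveIdempotents.span_eq [DecidableEq X] {S : AssocScheme X d}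
    {E : Fin (d + 1) → Matrix X X ℝ} (hE : S.IsPrimitiveIdempotents E) :
    Submodule.span ℝ (Set.range E) = S.boseMesner := by
  have hli : LinearIndependent ℝ E := by
    rw [Fintype.linearIndependent_iff]
    intro g hg k
    have h := hE.sum_smul_mul g k
    rw [hg, zero_mul] at h
    exact (smul_eq_zero.mp h.symm).resolve_right (hE.ne_zero k)
  apply Submodule.eq_of_le_of_finrank_le
  · rw [Submodule.span_le]
    rintro _ ⟨i, rfl⟩
    exact hE.mem i
  · rw [finrank_span_eq_card hli]
    exact finrank_range_le_card S.adj

theorem IsPrimitiveIdempotents.trace_ne_zero [DecidableEq X] {S : AssocScheme X d}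
    {E : Fin (d + 1) → Matrix X X ℝ} (hE : S.IsPrimitiveIdempotents E) (k : Fin (d + 1)) :
    (E k).trace ≠ 0 := by
  have hsymm : (E k)ᵀ = E k := by
    have h := hE.mem k
    unfold boseMesner at h
    generalize E k = M at h
    induction h using Submodule.span_induction with
    | mem M h =>
      obtain ⟨i, rfl⟩ := h
      ext x y
      simp [adj, S.rel_symm x y]
    | zero => simp
    | add M N _ _ h1 h2 => rw [Matrix.transpose_add, h1, h2]
    | smul c M _ h => rw [Matrix.transpose_smul, h]
  intro h0
  apply hE.ne_zero k
  rw [← Matrix.trace_conjTranspose_mul_self_eq_zero_iff,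
    Matrix.conjTranspose_eq_transpose_of_trivial, hsymm, hE.mul_self, h0]

/-- The numbers `krein E i j k` are the Krein numbers of the scheme. -/
theorem IsPrimitiveIdempotents.hadamard_eq_sum_krein [DecidableEq X] {S : AssocScheme X d}
    {E : Fin (d + 1) → Matrix X X ℝ} (hE : S.IsPrimitiveIdempotents E) (i j : Fin (d + 1)) :
    E i ⊙ E j = (Fintype.card X : ℝ)⁻¹ • ∑ k, krein E i j k • E k := by
  have hX : (Fintype.card X : ℝ) ≠ 0 := by
    obtain ⟨x, _⟩ := S.rel_nonempty 0
    have : Nonempty X := ⟨x⟩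
    exact_mod_cast Fintype.card_ne_zero
  have hmem := S.hadamard_mem_boseMesner (hE.mem i) (hE.mem j)
  rw [← hE.span_eq, Submodule.mem_span_range_iff_exists_fun] at hmem
  obtain ⟨g, hg⟩ := hmem
  have hk : ∀ k, krein E i j k = Fintype.card X * g k := by
    intro k
    rw [krein, ← hg, hE.sum_smul_mul g k, Matrix.trace_smul, smul_eq_mul]
    field_simp [hE.trace_ne_zero k]
  simp only [hk, mul_smul]
  rw [← Finset.smul_sum, smul_smul, inv_mul_cancel₀ hX, one_smul, hg]

end AssocScheme

/-!
The matrix `|X| E₁` is the Gram matrix of a spherical representation of `X`. By the `Q`-polynomial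
property, `q₁₁³ = 0`. The indicator of an antipodal class `Y` is a combination of a column of `E₀`
and one of `E₃`, and the vanishing theorem removes the `E₃` part of `∑ w ∈ Y, E₁(x,w) E₁(y,w)`,
leaving a multiple of `E₁(x,y)`: the vectors of `Y` form a regular simplex that spans the whole
space.

The cubic form `T(x,y,z) = ∑ w, E₁(x,w) E₁(y,w) E₁(z,w)` satisfies `T(x,x,z) = γ E₁(x,z)` with `γ`
a nonzero multiple of `a₁*`. If the scheme is triply regular, `T` is constant on triples of distinct
vertices of the simplex, so `γ` determines it on the simplex and, by linearity, everywhere.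
Comparing with `T(x,x,z) = γ E₁(x,z)` for `x` outside the class of `z` forces `γ = 0`, as `E₁`
separates the relations.

Conversely, let `K` be the adjacency matrix of the antipodality relation. The Bose–Mesner algebra is
spanned by `1`, `E₀`, `K` and `E₁`. Triple sums that involve `1` or `E₀` collapse to matrix products
in any scheme, those that involve `K` are sums over one antipodal class, and the remaining one, `T`,
vanishes identically when `a₁* = 0`.
-/

open Finset

section TripleSum

variable {X : Type*} [Fintype X]

/-- The triple sum `∑ w, A x w * B y w * C z w`, as a function of `x`, `y`, `z`. It is linear in
`A` too, but is bundled as a bilinear map in `B` and `C` only. -/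
def tripleSum (A : Matrix X X ℝ) : Matrix X X ℝ →ₗ[ℝ] Matrix X X ℝ →ₗ[ℝ] X → X → X → ℝ :=
  LinearMap.mk₂ ℝ (fun B C x y z => ∑ w, A x w * B y w * C z w)
    (fun B B' C => by ext; simp [mul_add, add_mul, sum_add_distrib])
    (fun c B C => by ext; simp [mul_sum, mul_left_comm, mul_assoc])
    (fun B C C' => by ext; simp [mul_add, sum_add_distrib])
    (fun c B C => by ext; simp [mul_sum, mul_left_comm])

theorem tripleSum_apply (A B C : Matrix X X ℝ) (x y z : X) :
    tripleSum A B C x y z = ∑ w, A x w * B y w * C z w := rfl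

theorem tripleSum_swap_left (A B C : Matrix X X ℝ) (x y z : X) :
    tripleSum A B C x y z = tripleSum B A C y x z := by
  simp only [tripleSum_apply, mul_comm (A x _)]

theorem tripleSum_swap_right (A B C : Matrix X X ℝ) (x y z : X) :
    tripleSum A B C x y z = tripleSum A C B x z y := by
  simp only [tripleSum_apply, mul_right_comm]

theorem tripleSum_rotate (A B C : Matrix X X ℝ) (x y z : X) :
    tripleSum A B C x y z = tripleSum B C A y z x := by
  rw [tripleSum_swap_left, tripleSum_swap_right]

theorem tripleSum_add_left (A A' B C : Matrix X X ℝ) :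
    tripleSum (A + A') B C = tripleSum A B C + tripleSum A' B C := by
  ext x y z
  simp [tripleSum_apply, add_mul, sum_add_distrib]

theorem tripleSum_smul_left (c : ℝ) (A B C : Matrix X X ℝ) :
    tripleSum (c • A) B C = c • tripleSum A B C := by
  ext x y z
  simp [tripleSum_apply, mul_sum, mul_assoc]

theorem tripleSum_self_left (A B C : Matrix X X ℝ) (x z : X) :
    tripleSum A B C x x z = ((A ⊙ B) * Cᵀ) x z := rfl

theorem tripleSum_eq_mulVec (A B C : Matrix X X ℝ) (x y z : X) :
    tripleSum A B C x y z = (C *ᵥ fun w => A x w * B y w) z := by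
  simp only [tripleSum_apply, Matrix.mulVec, dotProduct, mul_comm (C z _)]

theorem sum_sq_tripleSum (A B C : Matrix X X ℝ) :
    ∑ p : X × X × X, tripleSum A B C p.1 p.2.1 p.2.2 ^ 2 =
      (((Aᵀ * A) ⊙ (Bᵀ * B)) * (Cᵀ * C)).trace := by
  calc ∑ p : X × X × X, tripleSum A B C p.1 p.2.1 p.2.2 ^ 2
      = ∑ p : X × X × X, ∑ q : X × X,
          A p.1 q.1 * A p.1 q.2 * (B p.2.1 q.1 * B p.2.1 q.2) *
            (C p.2.2 q.1 * C p.2.2 q.2) := by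
        simp only [Fintype.sum_prod_type, tripleSum_apply, sq, sum_mul_sum]
        congr! 5
        ring
    _ = ∑ w, ∑ w', ((Aᵀ * A) ⊙ (Bᵀ * B) ⊙ (Cᵀ * C)) w w' := by
        rw [sum_comm]
        simp only [Fintype.sum_prod_type, Matrix.hadamard_apply, Matrix.mul_apply,
          Matrix.transpose_apply, ← mul_sum, ← sum_mul]
    _ = (((Aᵀ * A) ⊙ (Bᵀ * B)) * (Cᵀ * C)).trace := by
        rw [Matrix.sum_hadamard_eq, Matrix.transpose_mul, Matrix.transpose_transpose]

end TripleSum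

/-- `M` is the Gram matrix of a family of vectors of which those indexed by `Y` form a regular
simplex that spans the whole space; the vectors are scaled so that distinct vertices of the simplex
have inner product `-1`. That the simplex spans is expressed by its being a tight frame. -/
structure IsSpanningSimplex {X : Type*} [DecidableEq X] (M : Matrix X X ℝ) (Y : Finset X) :
    Prop where
  apply_eq : ∀ x ∈ Y, ∀ y ∈ Y, M x y = #Y * (1 : Matrix X X ℝ) x y - 1
  sum_mul_mul : ∀ x y, ∑ w ∈ Y, M x w * M y w = #Y * M x y

namespace IsSpanningSimplex

variable {X : Type*} [DecidableEq X] {M : Matrix X X ℝ} {Y : Finset X}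

theorem apply_self (h : IsSpanningSimplex M Y) {x : X} (hx : x ∈ Y) : M x x = #Y - 1 := by
  rw [h.apply_eq x hx x hx, Matrix.one_apply_eq, mul_one]

theorem apply_ne (h : IsSpanningSimplex M Y) {x y : X} (hx : x ∈ Y) (hy : y ∈ Y) (hxy : x ≠ y) :
    M x y = -1 := by
  rw [h.apply_eq x hx y hy, Matrix.one_apply_ne hxy, mul_zero, zero_sub]

theorem apply_comm (h : IsSpanningSimplex M Y) (hY : Y.Nonempty) (x y : X) : M x y = M y x := by
  have hv : (#Y : ℝ) ≠ 0 := by exact_mod_cast hY.card_ne_zero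
  apply mul_left_cancel₀ hv
  simp only [← h.sum_mul_mul, mul_comm]

theorem sum_apply (h : IsSpanningSimplex M Y) (x : X) : ∑ w ∈ Y, M x w = 0 := by
  obtain rfl | ⟨y, hy⟩ := Y.eq_empty_or_nonempty
  · rw [sum_empty]
  have hxy := h.sum_mul_mul x y
  rw [sum_congr rfl fun w hw => by rw [h.apply_eq y hy w hw]] at hxy
  simp only [Matrix.one_apply, mul_sub, mul_ite, mul_one, mul_zero, sum_sub_distrib, sum_ite_eq, hy,
    if_true] at hxy
  linarith

variable [Fintype X]

theorem sum_mulVec (h : IsSpanningSimplex M Y) (hY : Y.Nonempty) (c : X → ℝ) :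
    ∑ z ∈ Y, (M *ᵥ c) z = 0 := by
  simp only [Matrix.mulVec, dotProduct]
  rw [sum_comm]
  simp only [← sum_mul, h.apply_comm hY _ _, h.sum_apply, zero_mul, sum_const_zero]

theorem mulVec_apply_eq (h : IsSpanningSimplex M Y) (hY : Y.Nonempty) {c c' : X → ℝ}
    (hc : ∀ z ∈ Y, (M *ᵥ c) z = (M *ᵥ c') z) (x : X) : (M *ᵥ c) x = (M *ᵥ c') x := by
  have hv : (#Y : ℝ) ≠ 0 := by exact_mod_cast hY.card_ne_zero
  have expand (c : X → ℝ) : #Y * (M *ᵥ c) x = ∑ z ∈ Y, M x z * (M *ᵥ c) z := by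
    simp only [Matrix.mulVec, dotProduct, mul_sum]
    rw [sum_comm]
    simp only [← mul_assoc, ← h.sum_mul_mul, sum_mul, h.apply_comm hY _ (_ : X)]
  apply mul_left_cancel₀ hv
  rw [expand, expand]
  exact sum_congr rfl fun z hz => by rw [hc z hz]

theorem sum_tripleSum (h : IsSpanningSimplex M Y) (hY : Y.Nonempty) (x y : X) :
    ∑ z ∈ Y, tripleSum M M M x y z = 0 := by
  simp only [tripleSum_eq_mulVec, h.sum_mulVec hY]

section Cubic

variable {γ : ℝ}

theorem tripleSum_of_mem_of_ne (h : IsSpanningSimplex M Y)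
    (hγ : ∀ x z, tripleSum M M M x x z = γ * M x z)
    (hT : ∀ x ∈ Y, ∀ y ∈ Y, x ≠ y → ∀ z ∈ Y \ {x, y}, ∀ w ∈ Y \ {x, y},
      tripleSum M M M x y z = tripleSum M M M x y w)
    {x y z : X} (hx : x ∈ Y) (hy : y ∈ Y) (hxy : x ≠ y) (hz : z ∈ Y \ {x, y}) :
    (#Y - 2) * tripleSum M M M x y z = 2 * γ := by
  have hsub : {x, y} ⊆ Y := insert_subset hx (singleton_subset_iff.2 hy)
  have hcard : (#(Y \ {x, y}) : ℝ) = #Y - 2 := by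
    rw [cast_card_sdiff hsub, card_pair hxy, Nat.cast_two]
  have hrest : ∑ w ∈ Y \ {x, y}, tripleSum M M M x y w = (#Y - 2) * tripleSum M M M x y z := by
    rw [sum_congr rfl fun w hw => hT x hx y hy hxy w hw z hz, sum_const, nsmul_eq_mul, hcard]
  have hxyx : tripleSum M M M x y x = -γ := by
    rw [tripleSum_swap_right, hγ, h.apply_ne hx hy hxy, mul_neg_one]
  have hxyy : tripleSum M M M x y y = -γ := by
    rw [tripleSum_rotate, hγ, h.apply_ne hy hx hxy.symm, mul_neg_one]
  have hsum := h.sum_tripleSum ⟨x, hx⟩ x y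
  rw [← sum_sdiff hsub, sum_pair hxy, hrest, hxyx, hxyy] at hsum
  linarith

theorem tripleSum_of_mem (h : IsSpanningSimplex M Y)
    (hγ : ∀ x z, tripleSum M M M x x z = γ * M x z)
    (hT : ∀ x ∈ Y, ∀ y ∈ Y, x ≠ y → ∀ z ∈ Y \ {x, y}, ∀ w ∈ Y \ {x, y},
      tripleSum M M M x y z = tripleSum M M M x y w)
    {x y z : X} (hx : x ∈ Y) (hy : y ∈ Y) (hz : z ∈ Y) :
    (#Y - 2) * tripleSum M M M x y z = γ * (M x z * M y z - M x y) := by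
  obtain rfl | hxy := eq_or_ne x y
  · rw [hγ, h.apply_self hx, h.apply_eq x hx z hz, Matrix.one_apply]
    split_ifs <;> ring
  obtain rfl | hxz := eq_or_ne x z
  · rw [tripleSum_swap_right, hγ, h.apply_self hx, h.apply_ne hx hy hxy, h.apply_ne hy hx hxy.symm]
    ring
  obtain rfl | hyz := eq_or_ne y z
  · rw [tripleSum_rotate, hγ, h.apply_self hy, h.apply_ne hx hy hxy, h.apply_ne hy hx hxy.symm]
    ring
  · rw [h.tripleSum_of_mem_of_ne hγ hT hx hy hxy (by simp [hz, hxz.symm, hyz.symm]),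
      h.apply_ne hx hz hxz, h.apply_ne hy hz hyz, h.apply_ne hx hy hxy]
    ring

/-- Both sides of the formula on the simplex are linear in the rows of `x` and of `y`, so it extends
from the simplex to all `x` and `y`. -/
theorem tripleSum_eq (h : IsSpanningSimplex M Y)
    (hγ : ∀ x z, tripleSum M M M x x z = γ * M x z)
    (hT : ∀ x ∈ Y, ∀ y ∈ Y, x ≠ y → ∀ z ∈ Y \ {x, y}, ∀ w ∈ Y \ {x, y},
      tripleSum M M M x y z = tripleSum M M M x y w)
    {z : X} (hz : z ∈ Y) (x y : X) :
    (#Y - 2) * tripleSum M M M x y z = γ * (M x z * M y z - M x y) := by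
  have hY : Y.Nonempty := ⟨z, hz⟩
  have extend (y : X) (hy : ∀ x ∈ Y, (#Y - 2) * tripleSum M M M x y z =
      γ * (M x z * M y z - M x y)) (x : X) :
      (#Y - 2) * tripleSum M M M x y z = γ * (M x z * M y z - M x y) := by
    have left (x : X) : (#Y - 2) * tripleSum M M M x y z =
        (M *ᵥ ((#Y - 2 : ℝ) • fun w => M y w * M z w)) x := by
      rw [Matrix.mulVec_smul, Pi.smul_apply, ← tripleSum_eq_mulVec, smul_eq_mul, tripleSum_rotate]
    have right (x : X) : γ * (M x z * M y z - M x y) =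
        (M *ᵥ (γ • (M y z • Pi.single z 1 - Pi.single y 1))) x := by
      simp [Matrix.mulVec_smul, Matrix.mulVec_sub, mul_comm]
    rw [left, right]
    exact h.mulVec_apply_eq hY (fun x hx => by rw [← left, ← right, hy x hx]) x
  refine extend y (fun x hx => ?_) x
  rw [tripleSum_swap_left, extend x fun y hy => h.tripleSum_of_mem hγ hT hy hx hz,
    h.apply_comm hY y x, mul_comm (M x z)]

theorem eq_zero_of_tripleSum (h : IsSpanningSimplex M Y)
    (hγ : ∀ x z, tripleSum M M M x x z = γ * M x z)
    (hT : ∀ x ∈ Y, ∀ y ∈ Y, x ≠ y → ∀ z ∈ Y \ {x, y}, ∀ w ∈ Y \ {x, y},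
      tripleSum M M M x y z = tripleSum M M M x y w)
    {x y z : X} (hy : y ∈ Y) (hz : z ∈ Y) (hyz : y ≠ z) (hxx : M x x = M z z)
    (hxz : M x z ≠ M z z) (hxz' : M x z ≠ M y z) : γ = 0 := by
  have hcubic := h.tripleSum_eq hγ hT hz x x
  rw [hγ, hxx] at hcubic
  have hprod : γ * ((M x z - M z z) * (M x z - M y z)) = 0 := by
    rw [h.apply_self hz] at hcubic ⊢
    rw [h.apply_ne hy hz hyz]
    linear_combination -hcubic
  exact (mul_eq_zero.1 hprod).resolve_right (mul_ne_zero (sub_ne_zero.2 hxz) (sub_ne_zero.2 hxz'))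

end Cubic

end IsSpanningSimplex

namespace AssocScheme

section BoseMesner

variable {X : Type*} [Fintype X] {d : ℕ} {S : AssocScheme X d} {A B : Matrix X X ℝ}

theorem card_ne_zero (S : AssocScheme X d) : (Fintype.card X : ℝ) ≠ 0 := by
  obtain ⟨x, -⟩ := S.rel_nonempty 0
  have : Nonempty X := ⟨x⟩
  exact_mod_cast Fintype.card_ne_zero

theorem adj_apply (S : AssocScheme X d) (i : Fin (d + 1)) (x y : X) :
    S.adj i x y = if S.rel x y = i then 1 else 0 := rfl

theorem adj_mem_boseMesner (S : AssocScheme X d) (i : Fin (d + 1)) : S.adj i ∈ S.boseMesner :=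
  Submodule.subset_span ⟨i, rfl⟩

theorem exists_rel_eq (S : AssocScheme X d) (i : Fin (d + 1)) (x : X) : ∃ y, S.rel x y = i := by
  obtain ⟨a, b, hab⟩ := S.rel_nonempty i
  obtain ⟨p, hp⟩ := S.exists_intersection_number i i 0
  have hpos : 0 < p := by
    rw [← hp a a ((S.rel_eq_zero_iff a a).2 rfl), card_pos]
    exact ⟨b, by simp [hab, S.rel_symm b a]⟩
  rw [← hp x x ((S.rel_eq_zero_iff x x).2 rfl), card_pos] at hpos
  obtain ⟨y, hy⟩ := hpos
  exact ⟨y, (mem_filter.1 hy).2.1⟩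

theorem mem_boseMesner_iff :
    A ∈ S.boseMesner ↔ ∀ ⦃x y x' y'⦄, S.rel x y = S.rel x' y' → A x y = A x' y' := by
  constructor
  · intro hA x y x' y' hrel
    obtain ⟨g, rfl⟩ := (Submodule.mem_span_range_iff_exists_fun ℝ).1 hA
    simp only [Matrix.sum_apply, Matrix.smul_apply, adj_apply, hrel]
  · intro hA
    choose x y hxy using S.rel_nonempty
    refine (Submodule.mem_span_range_iff_exists_fun ℝ).2 ⟨fun i => A (x i) (y i), ?_⟩
    ext x' y'
    simpa [Matrix.sum_apply, adj_apply] using hA (hxy (S.rel x' y'))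

theorem transpose_eq_of_mem (hA : A ∈ S.boseMesner) : Aᵀ = A := by
  ext x y
  exact mem_boseMesner_iff.1 hA (S.rel_symm y x)

theorem adj_mul_adj_mem_boseMesner (S : AssocScheme X d) (i j : Fin (d + 1)) :
    S.adj i * S.adj j ∈ S.boseMesner := by
  refine mem_boseMesner_iff.2 fun x y x' y' hrel => ?_
  obtain ⟨p, hp⟩ := S.exists_intersection_number i j (S.rel x' y')
  have count (x y : X) : (S.adj i * S.adj j) x y = #{z | S.rel x z = i ∧ S.rel z y = j} := by
    simp [Matrix.mul_apply, adj_apply, ← ite_and, and_comm]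
  rw [count, count, hp x y hrel, hp x' y' rfl]

theorem mul_mem_boseMesner (hA : A ∈ S.boseMesner) (hB : B ∈ S.boseMesner) :
    A * B ∈ S.boseMesner := by
  refine LinearMap.BilinMap.apply_apply_mem_of_mem_span S.boseMesner (Set.range S.adj)
    (Set.range S.adj) (LinearMap.mul ℝ (Matrix X X ℝ)) ?_ A B hA hB
  rintro _ ⟨i, rfl⟩ _ ⟨j, rfl⟩
  exact S.adj_mul_adj_mem_boseMesner i j

theorem sum_adj_apply (S : AssocScheme X d) (I : Finset (Fin (d + 1))) (x y : X) :
    (∑ i ∈ I, S.adj i) x y = if S.rel x y ∈ I then 1 else 0 := by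
  simp [Matrix.sum_apply, adj_apply]

theorem sum_adj_mem_boseMesner (S : AssocScheme X d) (I : Finset (Fin (d + 1))) :
    ∑ i ∈ I, S.adj i ∈ S.boseMesner :=
  sum_mem fun i _ => S.adj_mem_boseMesner i

end BoseMesner

section PrimitiveIdempotents

variable {X : Type*} [Fintype X] [DecidableEq X] {d : ℕ} {S : AssocScheme X d}
  {E : Fin (d + 1) → Matrix X X ℝ}

namespace IsPrimitiveIdempotents

theorem zero_apply (hE : S.IsPrimitiveIdempotents E) (x y : X) :
    E 0 x y = (Fintype.card X : ℝ)⁻¹ := by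
  rw [hE.zero_eq, Matrix.smul_apply, Matrix.of_apply, smul_eq_mul, mul_one]

theorem transpose_eq (hE : S.IsPrimitiveIdempotents E) (i : Fin (d + 1)) : (E i)ᵀ = E i :=
  transpose_eq_of_mem (hE.mem i)

theorem apply_comm (hE : S.IsPrimitiveIdempotents E) (i : Fin (d + 1)) (x y : X) :
    E i x y = E i y x :=
  congrFun₂ (hE.transpose_eq i).symm x y

theorem sum_mul_apply (hE : S.IsPrimitiveIdempotents E) (i : Fin (d + 1)) (x y : X) :
    ∑ w, E i x w * E i y w = E i x y := by
  conv_rhs => rw [← hE.mul_self i, Matrix.mul_apply]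
  exact sum_congr rfl fun w _ => by rw [hE.apply_comm i y]

theorem card_mul_apply_self (hE : S.IsPrimitiveIdempotents E) (i : Fin (d + 1)) (x : X) :
    Fintype.card X * E i x x = (E i).trace := by
  have hdiag (y : X) : E i y y = E i x x := mem_boseMesner_iff.1 (hE.mem i)
    (((S.rel_eq_zero_iff y y).2 rfl).trans ((S.rel_eq_zero_iff x x).2 rfl).symm)
  simp [Matrix.trace, hdiag]

theorem apply_self_ne_zero (hE : S.IsPrimitiveIdempotents E) (i : Fin (d + 1)) (x : X) :
    E i x x ≠ 0 := fun h =>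
  hE.trace_ne_zero i (by rw [← hE.card_mul_apply_self i x, h, mul_zero])

theorem hadamard_mul (hE : S.IsPrimitiveIdempotents E) (i j k : Fin (d + 1)) :
    (E i ⊙ E j) * E k = (krein E i j k / Fintype.card X) • E k := by
  rw [hE.hadamard_eq_sum_krein, smul_mul_assoc, hE.sum_smul_mul, smul_smul, inv_mul_eq_div]

theorem tripleSum_card_smul_self (hE : S.IsPrimitiveIdempotents E) (j : Fin (d + 1)) (x z : X) :
    tripleSum ((Fintype.card X : ℝ) • E j) ((Fintype.card X : ℝ) • E j)
        ((Fintype.card X : ℝ) • E j) x x z =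
      Fintype.card X * krein E j j j * ((Fintype.card X : ℝ) • E j) x z := by
  have hX := S.card_ne_zero
  rw [tripleSum_self_left, Matrix.transpose_smul, hE.transpose_eq]
  simp only [Matrix.smul_hadamard, Matrix.hadamard_smul, smul_mul_assoc, mul_smul_comm,
    hE.hadamard_mul, Matrix.smul_apply, smul_eq_mul]
  field_simp

theorem krein_eq_zero_iff (hE : S.IsPrimitiveIdempotents E) (i j k : Fin (d + 1)) :
    krein E i j k = 0 ↔ (E i ⊙ E j) * E k = 0 := by
  rw [hE.hadamard_mul, smul_eq_zero, div_eq_zero_iff]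
  simp [S.card_ne_zero, hE.ne_zero]

/-- The vanishing theorem of Cameron, Goethals and Seidel. -/
theorem krein_eq_zero_iff_tripleSum (hE : S.IsPrimitiveIdempotents E) (i j k : Fin (d + 1)) :
    krein E i j k = 0 ↔ tripleSum (E i) (E j) (E k) = 0 := by
  have hsq : ∑ p : X × X × X, tripleSum (E i) (E j) (E k) p.1 p.2.1 p.2.2 ^ 2 =
      krein E i j k / Fintype.card X * (E k).trace := by
    simp only [sum_sq_tripleSum, hE.transpose_eq, hE.mul_self, hE.hadamard_mul, Matrix.trace_smul,
      smul_eq_mul]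
  calc krein E i j k = 0
      ↔ ∑ p : X × X × X, tripleSum (E i) (E j) (E k) p.1 p.2.1 p.2.2 ^ 2 = 0 := by
        simp [hsq, S.card_ne_zero, hE.trace_ne_zero]
    _ ↔ tripleSum (E i) (E j) (E k) = 0 := by
        simp [sum_eq_zero_iff_of_nonneg fun _ _ => sq_nonneg _, funext_iff]

end IsPrimitiveIdempotents

end PrimitiveIdempotents

section QPolynomial

variable {X : Type*} [Fintype X] [DecidableEq X] {d : ℕ} {S : AssocScheme X d}
  {E : Fin (d + 1) → Matrix X X ℝ}

theorem IsQPolynomial.exists_sequence (hQ : S.IsQPolynomial E) :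
    ∃ P : Polynomial.Sequence ℝ, ∀ (i : Fin (d + 1)) (x y : X),
      Fintype.card X * E i x y = (P i).eval (Fintype.card X * E 1 x y) := by
  choose p hdegree hp using hQ.2
  refine ⟨⟨fun i => if h : i < d + 1 then p ⟨i, h⟩ else Polynomial.X ^ i, fun i => ?_⟩,
    fun i x y => ?_⟩
  · split_ifs with h
    exacts [hdegree ⟨i, h⟩, Polynomial.degree_X_pow i]
  · simp [hp i x y, i.is_le]

theorem IsQPolynomial.map_eval_mul_eq_zero (hQ : S.IsQPolynomial E) {p : Polynomial ℝ}
    {k : Fin (d + 1)} (hp : p.degree < (k : ℕ)) :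
    (E 1).map (fun t => p.eval (Fintype.card X * t)) * E k = 0 := by
  obtain ⟨P, hP⟩ := hQ.exists_sequence
  have hmem : p ∈ Submodule.span ℝ (P '' Set.Iio (k : ℕ)) := by
    rwa [P.span_degreeLT (by simp), Polynomial.mem_degreeLT]
  clear hp
  induction hmem using Submodule.span_induction with
  | mem _ h =>
    obtain ⟨i, hi, rfl⟩ := h
    obtain ⟨i, rfl⟩ : ∃ i' : Fin (d + 1), i' = i := ⟨⟨i, hi.trans k.isLt⟩, rfl⟩
    have hEi : (E 1).map (fun t => (P i).eval (Fintype.card X * t)) =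
        (Fintype.card X : ℝ) • E i := by
      ext x y
      exact (hP i x y).symm
    rw [hEi, smul_mul_assoc, hQ.1.mul_ne i k (Fin.ne_of_lt hi), smul_zero]
  | zero => ext; simp [Matrix.mul_apply]
  | add p q _ _ hp hq =>
    have hadd : (E 1).map (fun t => (p + q).eval (Fintype.card X * t)) =
        (E 1).map (fun t => p.eval (Fintype.card X * t)) +
          (E 1).map (fun t => q.eval (Fintype.card X * t)) := by
      ext; simp
    rw [hadd, add_mul, hp, hq, add_zero]
  | smul c p _ hp =>
    have hsmul : (E 1).map (fun t => (c • p).eval (Fintype.card X * t)) =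
        c • (E 1).map (fun t => p.eval (Fintype.card X * t)) := by
      ext; simp
    rw [hsmul, smul_mul_assoc, hp, smul_zero]

theorem IsQPolynomial.krein_eq_zero (hQ : S.IsQPolynomial E) {i j k : Fin (d + 1)}
    (hijk : (i + j : ℕ) < k) : krein E i j k = 0 := by
  obtain ⟨P, hP⟩ := hQ.exists_sequence
  have hEij : (E 1).map (fun t => (P i * P j).eval (Fintype.card X * t)) =
      (Fintype.card X ^ 2 : ℝ) • (E i ⊙ E j) := by
    ext x y
    simp only [Matrix.map_apply, Polynomial.eval_mul, ← hP, Matrix.smul_apply,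
      Matrix.hadamard_apply, smul_eq_mul]
    ring
  have hzero := hQ.map_eval_mul_eq_zero (p := P i * P j) (k := k)
    (by simpa [Polynomial.degree_mul] using mod_cast hijk)
  rw [hEij, smul_mul_assoc, smul_eq_zero] at hzero
  exact (hQ.1.krein_eq_zero_iff i j k).2 (hzero.resolve_left (pow_ne_zero 2 S.card_ne_zero))

theorem IsQPolynomial.rel_eq (hQ : S.IsQPolynomial E) {x y x' y' : X}
    (h : E 1 x y = E 1 x' y') : S.rel x y = S.rel x' y' := by
  have hE (i : Fin (d + 1)) : E i x y = E i x' y' := by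
    obtain ⟨p, -, hp⟩ := hQ.2 i
    apply mul_left_cancel₀ S.card_ne_zero
    rw [hp, hp, h]
  obtain ⟨g, hg⟩ := (Submodule.mem_span_range_iff_exists_fun ℝ).1
    (hQ.1.span_eq.symm ▸ S.adj_mem_boseMesner (S.rel x' y'))
  have hadj : S.adj (S.rel x' y') x y = S.adj (S.rel x' y') x' y' := by
    simp only [← hg, Matrix.sum_apply, Matrix.smul_apply, hE]
  simpa [adj_apply] using hadj

end QPolynomial

section Fibres

variable {X : Type*} [Fintype X] {d : ℕ}

/-- The set of all `y` with `(x, y)` in the union of the relations `R_i`, `i ∈ I`; this is the class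
of `x` when that union is an equivalence relation. -/
def fibre (S : AssocScheme X d) (I : Finset (Fin (d + 1))) (x : X) : Finset X :=
  {y | S.rel x y ∈ I}

variable {S : AssocScheme X d} {I : Finset (Fin (d + 1))} {E : Fin (d + 1) → Matrix X X ℝ}

theorem mem_fibre {x y : X} : y ∈ S.fibre I x ↔ S.rel x y ∈ I := by
  simp [fibre]

theorem rel_eq_of_mem_fibre {s : Fin (d + 1)} {x y : X} (hy : y ∈ S.fibre {0, s} x)
    (hxy : x ≠ y) : S.rel x y = s := by
  rw [mem_fibre, mem_insert, S.rel_eq_zero_iff, mem_singleton] at hy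
  exact hy.resolve_left hxy

theorem tripleSum_sum_adj (A B : Matrix X X ℝ) (x y u : X) :
    tripleSum A B (∑ i ∈ I, S.adj i) x y u = ∑ w ∈ S.fibre I u, A x w * B y w := by
  simp [tripleSum_apply, sum_adj_apply, fibre, sum_filter]

theorem sum_adj_mul_apply (A : Matrix X X ℝ) (u x : X) :
    ((∑ i ∈ I, S.adj i) * A) u x = ∑ w ∈ S.fibre I u, A w x := by
  simp [Matrix.mul_apply, sum_adj_apply, fibre, sum_filter]

namespace IsQAntipodalRelation

theorem mem_fibre_self (hI : S.IsQAntipodalRelation E I) (x : X) : x ∈ S.fibre I x :=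
  mem_fibre.2 (hI.1.refl x)

theorem fibre_eq (hI : S.IsQAntipodalRelation E I) {x y : X} (hy : y ∈ S.fibre I x) :
    S.fibre I y = S.fibre I x := by
  rw [mem_fibre] at hy
  ext z
  rw [mem_fibre, mem_fibre]
  exact ⟨hI.1.trans hy, hI.1.trans (hI.1.symm hy)⟩

variable [DecidableEq X] {j s : Fin (d + 1)}

theorem sum_fibre_apply (hI : S.IsQAntipodalRelation E {0, s}) (hE : S.IsPrimitiveIdempotents E)
    {a b : X} (hab : S.rel a b = s) (x : X) (f : ℝ → ℝ) :
    ∑ w ∈ S.fibre {0, s} x, f (E j x w) =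
      f (E j x x) + (#(S.fibre {0, s} x) - 1) * f (E j a b) := by
  have hne : ∀ w ∈ (S.fibre {0, s} x).erase x, f (E j x w) = f (E j a b) := by
    intro w hw
    obtain ⟨hwx, hw⟩ := mem_erase.1 hw
    rw [mem_boseMesner_iff.1 (hE.mem j) ((rel_eq_of_mem_fibre hw hwx.symm).trans hab.symm)]
  have hx := hI.mem_fibre_self x
  rw [← add_sum_erase _ _ hx, sum_congr rfl hne, sum_const, nsmul_eq_mul, cast_card_erase_of_mem hx]

variable [NeZero d]

theorem card_fibre_eq (hE : S.IsPrimitiveIdempotents E) {c : ℝ}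
    (hc : ∑ i ∈ I, S.adj i = c • (E 0 + E (Fin.last d))) (u : X) : (#(S.fibre I u) : ℝ) = c := by
  have hzero : (∑ i ∈ I, S.adj i) * E 0 = c • E 0 := by
    rw [hc, smul_mul_assoc, add_mul, hE.mul_self, hE.mul_ne _ _ Fin.last_pos'.ne', add_zero]
  have hcard := congrFun₂ hzero u u
  rw [sum_adj_mul_apply] at hcard
  simp only [hE.zero_apply, sum_const, nsmul_eq_mul, Matrix.smul_apply, smul_eq_mul] at hcard
  exact mul_right_cancel₀ (inv_ne_zero S.card_ne_zero) hcard

theorem sum_adj_eq (hI : S.IsQAntipodalRelation E I) (hE : S.IsPrimitiveIdempotents E) (u : X) :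
    ∑ i ∈ I, S.adj i = (#(S.fibre I u) : ℝ) • (E 0 + E (Fin.last d)) := by
  obtain ⟨c, hc⟩ := hI.2
  rw [card_fibre_eq hE hc, hc]

theorem sum_apply (hI : S.IsQAntipodalRelation E I) (hE : S.IsPrimitiveIdempotents E)
    (hj : j ≠ 0) (hj' : j ≠ Fin.last d) (u x : X) : ∑ w ∈ S.fibre I u, E j x w = 0 := by
  simp only [hE.apply_comm j x]
  rw [← sum_adj_mul_apply, hI.sum_adj_eq hE u, smul_mul_assoc, add_mul, hE.mul_ne _ _ hj.symm,
    hE.mul_ne _ _ hj'.symm, add_zero, smul_zero, Matrix.zero_apply]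

theorem sum_mul_apply (hI : S.IsQAntipodalRelation E I) (hE : S.IsPrimitiveIdempotents E)
    (hj : krein E j j (Fin.last d) = 0) (u x y : X) :
    ∑ w ∈ S.fibre I u, E j x w * E j y w = #(S.fibre I u) / Fintype.card X * E j x y := by
  have hzero : tripleSum (E j) (E j) (E 0) x y u = (Fintype.card X : ℝ)⁻¹ * E j x y := by
    simp only [tripleSum_apply, hE.zero_apply, ← sum_mul, hE.sum_mul_apply, mul_comm]
  rw [← tripleSum_sum_adj, hI.sum_adj_eq hE u, map_smul, map_add,
    (hE.krein_eq_zero_iff_tripleSum _ _ _).1 hj, add_zero]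
  simp only [Pi.smul_apply, hzero, smul_eq_mul, div_eq_mul_inv, mul_assoc]

theorem apply_of_mem_fibre (hI : S.IsQAntipodalRelation E {0, s}) (hE : S.IsPrimitiveIdempotents E)
    (hj : j ≠ 0) (hj' : j ≠ Fin.last d) (hjj : krein E j j (Fin.last d) = 0) {x y : X}
    (hy : y ∈ S.fibre {0, s} x) :
    Fintype.card X * E j x y = #(S.fibre {0, s} x) * (1 : Matrix X X ℝ) x y - 1 := by
  obtain ⟨a, b, hab⟩ := S.rel_nonempty s
  have hv : (#(S.fibre {0, s} x) : ℝ) ≠ 0 := by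
    exact_mod_cast card_ne_zero_of_mem (hI.mem_fibre_self x)
  have hX := S.card_ne_zero
  have hsum : E j x x + (#(S.fibre {0, s} x) - 1) * E j a b = 0 := by
    simpa only [id_eq, hI.sum_apply hE hj hj'] using (hI.sum_fibre_apply (j := j) hE hab x id).symm
  have hsum_sq : E j x x ^ 2 + (#(S.fibre {0, s} x) - 1) * E j a b ^ 2 =
      #(S.fibre {0, s} x) / Fintype.card X * E j x x := by
    rw [← hI.sum_fibre_apply hE hab x (· ^ 2), ← hI.sum_mul_apply hE hjj x x x]
    simp only [sq]
  have hdiff : Fintype.card X * (E j x x - E j a b) = #(S.fibre {0, s} x) := by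
    apply mul_right_cancel₀ (hE.apply_self_ne_zero j x)
    field_simp at hsum_sq
    linear_combination hsum_sq - Fintype.card X * E j a b * hsum
  have hab_eq : Fintype.card X * E j a b = -1 := by
    apply mul_left_cancel₀ hv
    linear_combination Fintype.card X * hsum - hdiff
  rw [Matrix.one_apply]
  split_ifs with hxy
  · subst hxy
    linear_combination hdiff + hab_eq
  · rw [mem_boseMesner_iff.1 (hE.mem j) ((rel_eq_of_mem_fibre hy hxy).trans hab.symm), hab_eq,
      mul_zero, zero_sub]

theorem isSpanningSimplex (hI : S.IsQAntipodalRelation E {0, s}) (hE : S.IsPrimitiveIdempotents E)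
    (hj : j ≠ 0) (hj' : j ≠ Fin.last d) (hjj : krein E j j (Fin.last d) = 0) (u : X) :
    IsSpanningSimplex ((Fintype.card X : ℝ) • E j) (S.fibre {0, s} u) where
  apply_eq x hx y hy := by
    rw [← hI.fibre_eq hx] at hy ⊢
    exact hI.apply_of_mem_fibre hE hj hj' hjj hy
  sum_mul_mul x y := by
    have hX := S.card_ne_zero
    simp only [Matrix.smul_apply, smul_eq_mul, mul_mul_mul_comm _ (E j x _), ← mul_sum,
      hI.sum_mul_apply hE hjj]
    field_simp

end IsQAntipodalRelation

end Fibres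

section TripleRegularity

variable {X : Type*} [Fintype X] {d : ℕ} {S : AssocScheme X d}

/-- The functions of three points `x`, `y`, `z` whose value depends only on the relations that
contain `(x, y)`, `(y, z)` and `(z, x)`. -/
def tripleInvariants (S : AssocScheme X d) : Submodule ℝ (X → X → X → ℝ) where
  carrier := {f | ∀ ⦃x y z x' y' z'⦄, S.rel x y = S.rel x' y' → S.rel y z = S.rel y' z' →
    S.rel z x = S.rel z' x' → f x y z = f x' y' z'}
  zero_mem' _ _ _ _ _ _ _ _ _ := rfl
  add_mem' hf hg _ _ _ _ _ _ hxy hyz hzx := congrArg₂ (· + ·) (hf hxy hyz hzx) (hg hxy hyz hzx)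
  smul_mem' c _ hf _ _ _ _ _ _ hxy hyz hzx := congrArg (c * ·) (hf hxy hyz hzx)

theorem swap_mem_tripleInvariants {f : X → X → X → ℝ} (hf : f ∈ S.tripleInvariants) :
    (fun x y z => f y x z) ∈ S.tripleInvariants := fun x y z x' y' z' hxy hyz hzx =>
  hf (by rw [S.rel_symm y, S.rel_symm y', hxy]) (by rw [S.rel_symm x, S.rel_symm x', hzx])
    (by rw [S.rel_symm z, S.rel_symm z', hyz])

theorem rotate_mem_tripleInvariants {f : X → X → X → ℝ} (hf : f ∈ S.tripleInvariants) :
    (fun x y z => f z x y) ∈ S.tripleInvariants := fun _ _ _ _ _ _ hxy hyz hzx =>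
  hf hzx hxy hyz

/-- The matrices `A` for which all triple sums of `A` with two members of the Bose–Mesner algebra
are invariant. The scheme is triply regular if this is the whole Bose–Mesner algebra; the point of
the definition is that it suffices to check a spanning set. -/
def tripleRegularPart (S : AssocScheme X d) : Submodule ℝ (Matrix X X ℝ) where
  carrier := {A | ∀ B ∈ S.boseMesner, ∀ C ∈ S.boseMesner, tripleSum A B C ∈ S.tripleInvariants}
  zero_mem' B _ C _ := by
    rw [← zero_smul ℝ 0, tripleSum_smul_left, zero_smul]
    exact zero_mem _
  add_mem' hA hA' B hB C hC := by
    rw [tripleSum_add_left]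
    exact add_mem (hA B hB C hC) (hA' B hB C hC)
  smul_mem' c A hA B hB C hC := by
    rw [tripleSum_smul_left]
    exact Submodule.smul_mem _ c (hA B hB C hC)

variable {A B C : Matrix X X ℝ}

theorem tripleSum_rotate_mem (h : tripleSum C A B ∈ S.tripleInvariants) :
    tripleSum A B C ∈ S.tripleInvariants := by
  have hrotate : tripleSum A B C = fun x y z => tripleSum C A B z x y := by
    ext x y z
    exact (tripleSum_rotate C A B z x y).symm
  rw [hrotate]
  exact rotate_mem_tripleInvariants h

theorem tripleSum_swap_mem (h : tripleSum B A C ∈ S.tripleInvariants) :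
    tripleSum A B C ∈ S.tripleInvariants := by
  have hswap : tripleSum A B C = fun x y z => tripleSum B A C y x z := by
    ext x y z
    exact tripleSum_swap_left A B C x y z
  rw [hswap]
  exact swap_mem_tripleInvariants h

theorem mem_tripleRegularPart_of_span {s : Set (Matrix X X ℝ)}
    (hs : Submodule.span ℝ s = S.boseMesner) (hA : A ∈ S.boseMesner)
    (h : ∀ B ∈ s, ∀ C ∈ s, B ∈ S.tripleRegularPart ∨ C ∈ S.tripleRegularPart ∨
      tripleSum A B C ∈ S.tripleInvariants) : A ∈ S.tripleRegularPart := by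
  intro B hB C hC
  refine LinearMap.BilinMap.apply_apply_mem_of_mem_span S.tripleInvariants s s (tripleSum A)
    (fun B hB C hC => ?_) B C (hs ▸ hB) (hs ▸ hC)
  have hsub : s ⊆ S.boseMesner := Submodule.span_le.1 hs.le
  rcases h B hB C hC with hB' | hC' | hABC
  · exact tripleSum_swap_mem (hB' A hA C (hsub hC))
  · exact tripleSum_rotate_mem (hC' A hA B (hsub hB))
  · exact hABC

theorem tripleSum_adj (S : AssocScheme X d) (l m n : Fin (d + 1)) (x y z : X) :
    tripleSum (S.adj l) (S.adj m) (S.adj n) x y z =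
      #{w | S.rel x w = l ∧ S.rel y w = m ∧ S.rel z w = n} := by
  simp [tripleSum_apply, adj_apply, ← ite_and, and_comm, and_assoc]

theorem isTriplyRegular_iff : S.IsTriplyRegular ↔ S.boseMesner ≤ S.tripleRegularPart := by
  constructor
  · refine fun h => Submodule.span_le.2 ?_
    rintro _ ⟨l, rfl⟩
    refine mem_tripleRegularPart_of_span rfl (S.adj_mem_boseMesner l) ?_
    rintro _ ⟨m, rfl⟩ _ ⟨n, rfl⟩
    refine .inr (.inr fun x y z x' y' z' hxy hyz hzx => ?_)
    obtain ⟨p, hp⟩ := h (S.rel x' y') (S.rel y' z') (S.rel z' x') l m n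
    rw [tripleSum_adj, tripleSum_adj, hp x y z hxy hyz hzx, hp x' y' z' rfl rfl rfl]
  · intro h i j k l m n
    by_cases hex : ∃ x y z, S.rel x y = i ∧ S.rel y z = j ∧ S.rel z x = k
    · obtain ⟨x', y', z', rfl, rfl, rfl⟩ := hex
      refine ⟨#{w | S.rel x' w = l ∧ S.rel y' w = m ∧ S.rel z' w = n}, fun x y z hxy hyz hzx => ?_⟩
      have hsum := h (S.adj_mem_boseMesner l) _ (S.adj_mem_boseMesner m) _
        (S.adj_mem_boseMesner n) hxy hyz hzx
      rwa [tripleSum_adj, tripleSum_adj, Nat.cast_inj] at hsum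
    · exact ⟨0, fun x y z hxy hyz hzx => (hex ⟨x, y, z, hxy, hyz, hzx⟩).elim⟩

variable [DecidableEq X]

theorem one_mem_tripleRegularPart (S : AssocScheme X d) : 1 ∈ S.tripleRegularPart := by
  intro B hB C hC x y z x' y' z' hxy _ hzx
  have hyx : S.rel y x = S.rel y' x' := by rw [S.rel_symm y, S.rel_symm y', hxy]
  have hone (x y z : X) : tripleSum 1 B C x y z = B y x * C z x := by
    simp [tripleSum_apply, Matrix.one_apply]
  rw [hone, hone, mem_boseMesner_iff.1 hB hyx, mem_boseMesner_iff.1 hC hzx]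

theorem IsPrimitiveIdempotents.zero_mem_tripleRegularPart {E : Fin (d + 1) → Matrix X X ℝ}
    (hE : S.IsPrimitiveIdempotents E) : E 0 ∈ S.tripleRegularPart := by
  intro B hB C hC x y z x' y' z' _ hyz _
  have hzero (x y z : X) : tripleSum (E 0) B C x y z = (Fintype.card X : ℝ)⁻¹ * (B * C) y z := by
    simp only [tripleSum_apply, hE.zero_apply, Matrix.mul_apply, mul_sum, mul_assoc]
    refine sum_congr rfl fun w _ => ?_
    rw [mem_boseMesner_iff.1 hC (S.rel_symm z w)]
  rw [hzero, hzero, mem_boseMesner_iff.1 (mul_mem_boseMesner hB hC) hyz]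

end TripleRegularity

section Antipodal

variable {X : Type*} [Fintype X] {d : ℕ} {S : AssocScheme X d}
  {E : Fin (d + 1) → Matrix X X ℝ} {I : Finset (Fin (d + 1))}

theorem tripleSum_sum_adj_sum_adj_mem (hI : Equivalence fun x y => S.rel x y ∈ I) {C : Matrix X X ℝ}
    (hC : C ∈ S.boseMesner) :
    tripleSum (∑ i ∈ I, S.adj i) (∑ i ∈ I, S.adj i) C ∈ S.tripleInvariants := by
  intro x y z x' y' z' hxy _ hzx
  set K := ∑ i ∈ I, S.adj i with hK
  have hKmem : K ∈ S.boseMesner := S.sum_adj_mem_boseMesner I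
  have hKK (x y w : X) : K x w * K y w = K x y * K w x := by
    have hiff : S.rel x w ∈ I ∧ S.rel y w ∈ I ↔ S.rel x y ∈ I ∧ S.rel w x ∈ I :=
      ⟨fun h => ⟨hI.trans h.1 (hI.symm h.2), hI.symm h.1⟩,
        fun h => ⟨hI.symm h.2, hI.trans (hI.symm h.1) (hI.symm h.2)⟩⟩
    simp only [hK, sum_adj_apply, mul_ite, mul_one, mul_zero, ← ite_and]
    exact if_congr (by rw [and_comm, hiff, and_comm]) rfl rfl
  have hsum (x y z : X) : tripleSum K K C x y z = K x y * (C * K) z x := by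
    simp only [tripleSum_apply, hKK, Matrix.mul_apply, mul_sum, mul_assoc, mul_comm (C z _)]
  rw [hsum, hsum, mem_boseMesner_iff.1 hKmem hxy,
    mem_boseMesner_iff.1 (mul_mem_boseMesner hC hKmem) hzx]

namespace IsQAntipodalRelation

variable [DecidableEq X]

theorem tripleSum_sum_adj_mem [NeZero d] (hI : S.IsQAntipodalRelation E I)
    (hE : S.IsPrimitiveIdempotents E) {j : Fin (d + 1)} (hj : krein E j j (Fin.last d) = 0) :
    tripleSum (∑ i ∈ I, S.adj i) (E j) (E j) ∈ S.tripleInvariants := by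
  obtain ⟨c, hc⟩ := hI.2
  have hsum (x y z : X) : tripleSum (∑ i ∈ I, S.adj i) (E j) (E j) x y z =
      c / Fintype.card X * E j y z := by
    rw [tripleSum_rotate, tripleSum_sum_adj, hI.sum_mul_apply hE hj, card_fibre_eq hE hc]
  intro x y z x' y' z' _ hyz _
  rw [hsum, hsum, mem_boseMesner_iff.1 (hE.mem j) hyz]

theorem apply_eq_of_mem_fibre {s : Fin (d + 1)} (hI : S.IsQAntipodalRelation E {0, s})
    {f : X → X → X → ℝ} (hf : f ∈ S.tripleInvariants) {u x y z w : X}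
    (hx : x ∈ S.fibre {0, s} u) (hy : y ∈ S.fibre {0, s} u)
    (hz : z ∈ S.fibre {0, s} u \ {x, y}) (hw : w ∈ S.fibre {0, s} u \ {x, y}) :
    f x y z = f x y w := by
  have rel_eq {a b : X} (ha : a ∈ S.fibre {0, s} u) (hb : b ∈ S.fibre {0, s} u) (hab : b ≠ a) :
      S.rel a b = s := rel_eq_of_mem_fibre ((hI.fibre_eq ha).symm ▸ hb) hab.symm
  simp only [mem_sdiff, mem_insert, mem_singleton, not_or] at hz hw
  obtain ⟨hz, hzx, hzy⟩ := hz
  obtain ⟨hw, hwx, hwy⟩ := hw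
  have hyz : S.rel y z = S.rel y w := by rw [rel_eq hy hz hzy, rel_eq hy hw hwy]
  have hxz : S.rel x z = S.rel x w := by rw [rel_eq hx hz hzx, rel_eq hx hw hwx]
  exact hf rfl hyz (by rw [S.rel_symm z, hxz, S.rel_symm])

theorem aStar_one_eq_zero {s : Fin (d + 1)} (hI : S.IsQAntipodalRelation E {0, s})
    (hQ : S.IsQPolynomial E) (hd : 2 < d) (hs : s ≠ 0) (hS : S.IsTriplyRegular) :
    aStar E 1 = 0 := by
  have hE := hQ.1
  have hX := S.card_ne_zero
  set M : Matrix X X ℝ := (Fintype.card X : ℝ) • E 1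
  have hM : M ∈ S.boseMesner := Submodule.smul_mem _ _ (hE.mem 1)
  have hinv : tripleSum M M M ∈ S.tripleInvariants := isTriplyRegular_iff.1 hS hM M hM M hM
  have separates {x y x' y' : X} (h : S.rel x y ≠ S.rel x' y') : M x y ≠ M x' y' := fun hxy =>
    h (hQ.rel_eq (mul_left_cancel₀ hX hxy))
  obtain ⟨i, -, hi⟩ : ∃ i ∈ univ, i ∉ ({0, s} : Finset (Fin (d + 1))) :=
    exists_mem_notMem_of_card_lt_card (by
      rw [card_pair hs.symm, card_univ, Fintype.card_fin]
      omega)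
  obtain ⟨x, z, hxz⟩ := S.rel_nonempty i
  obtain ⟨y, hzy⟩ := S.exists_rel_eq s z
  have hy : y ∈ S.fibre {0, s} z := mem_fibre.2 (by simp [hzy])
  simp only [mem_insert, mem_singleton, not_or] at hi
  have hzz : S.rel z z = 0 := (S.rel_eq_zero_iff z z).2 rfl
  have hyz : S.rel y z = s := by rw [S.rel_symm, hzy]
  have : NeZero d := ⟨by omega⟩
  have hone : ((1 : Fin (d + 1)) : ℕ) = 1 := by rw [Fin.val_one', Nat.mod_eq_of_lt (by omega)]
  have hone_ne_zero : (1 : Fin (d + 1)) ≠ 0 := fun h => by simp [h] at hone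
  have hone_ne_last : (1 : Fin (d + 1)) ≠ Fin.last d := fun h => by
    rw [h, Fin.val_last] at hone
    omega
  have hkrein : krein E 1 1 (Fin.last d) = 0 := hQ.krein_eq_zero (by rwa [hone, Fin.val_last])
  have hsimplex := hI.isSpanningSimplex hE hone_ne_zero hone_ne_last hkrein z
  have hγ_zero := hsimplex.eq_zero_of_tripleSum (hE.tripleSum_card_smul_self 1)
    (fun a ha b hb _ c hc e he => hI.apply_eq_of_mem_fibre hinv ha hb hc he)
    hy (hI.mem_fibre_self z) (x := x) (fun hyz' => hs (by rw [← hyz, hyz', hzz]))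
    (mem_boseMesner_iff.1 hM (hzz ▸ (S.rel_eq_zero_iff x x).2 rfl))
    (separates (by rw [hxz, hzz]; exact hi.1)) (separates (by rw [hxz, hyz]; exact hi.2))
  exact (mul_eq_zero.1 hγ_zero).resolve_left hX

end IsQAntipodalRelation

end Antipodal

section ThreeClasses

variable {X : Type*} [Fintype X] [DecidableEq X] {S : AssocScheme X 3} {E : Fin 4 → Matrix X X ℝ}
  {I : Finset (Fin 4)}

theorem span_eq_boseMesner (hE : S.IsPrimitiveIdempotents E) (hI : S.IsQAntipodalRelation E I) :
    Submodule.span ℝ {1, E 0, ∑ i ∈ I, S.adj i, E 1} = S.boseMesner := by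
  have hone : (1 : Matrix X X ℝ) ∈ S.boseMesner := hE.sum_eq_one ▸ sum_mem fun i _ => hE.mem i
  apply le_antisymm
  · simp [Submodule.span_le, Set.insert_subset_iff, hone, hE.mem, S.sum_adj_mem_boseMesner]
  set V := Submodule.span ℝ {1, E 0, ∑ i ∈ I, S.adj i, E 1}
  have h1 : 1 ∈ V := Submodule.subset_span (by simp)
  have hE0 : E 0 ∈ V := Submodule.subset_span (by simp)
  have hK : ∑ i ∈ I, S.adj i ∈ V := Submodule.subset_span (by simp)
  have hE1 : E 1 ∈ V := Submodule.subset_span (by simp)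
  have hE3 : E 3 ∈ V := by
    obtain ⟨x, -⟩ := S.rel_nonempty 0
    have hv : (#(S.fibre I x) : ℝ) ≠ 0 := by
      exact_mod_cast card_ne_zero_of_mem (hI.mem_fibre_self x)
    rw [hI.sum_adj_eq hE x, V.smul_mem_iff hv] at hK
    exact (V.add_mem_iff_right hE0).1 hK
  have hE2 : E 2 ∈ V := by
    have hsum := hE.sum_eq_one
    rw [Fin.sum_univ_four] at hsum
    rw [← hsum, V.add_mem_iff_left hE3, V.add_mem_iff_right (V.add_mem hE0 hE1)] at h1
    exact h1
  rw [← hE.span_eq, Submodule.span_le]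
  rintro _ ⟨i, rfl⟩
  fin_cases i
  exacts [hE0, hE1, hE2, hE3]

theorem isTriplyRegular_of_aStar_one_eq_zero (hE : S.IsPrimitiveIdempotents E)
    (hI : S.IsQAntipodalRelation E I) (hq : krein E 1 1 3 = 0) (ha : aStar E 1 = 0) :
    S.IsTriplyRegular := by
  have hspan := span_eq_boseMesner hE hI
  have hone := S.one_mem_tripleRegularPart
  have hE0 := hE.zero_mem_tripleRegularPart
  have hKmem := S.sum_adj_mem_boseMesner I
  have hKKK := tripleSum_sum_adj_sum_adj_mem hI.1 hKmem
  have hKKE := tripleSum_sum_adj_sum_adj_mem hI.1 (hE.mem 1)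
  have hKEE := hI.tripleSum_sum_adj_mem hE hq
  have hK : ∑ i ∈ I, S.adj i ∈ S.tripleRegularPart := by
    refine mem_tripleRegularPart_of_span hspan hKmem ?_
    rintro B (rfl | rfl | rfl | rfl) C (rfl | rfl | rfl | rfl) <;>
    simp only [hone, hE0, hKKE, tripleSum_rotate_mem hKKE, hKKK, hKEE, true_or, or_true]
  have hE1 : E 1 ∈ S.tripleRegularPart := by
    refine mem_tripleRegularPart_of_span hspan (hE.mem 1) ?_
    have hzero : tripleSum (E 1) (E 1) (E 1) = 0 := (hE.krein_eq_zero_iff_tripleSum 1 1 1).1 ha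
    rintro B (rfl | rfl | rfl | rfl) C (rfl | rfl | rfl | rfl) <;> simp [hone, hE0, hK, hzero]
  rw [isTriplyRegular_iff, ← hspan, Submodule.span_le]
  simp [Set.insert_subset_iff, hone, hE0, hK, hE1]

end ThreeClasses

end AssocScheme

theorem theorem2p1 {X : Type*} [Fintype X] [DecidableEq X] (S : AssocScheme X 3)
    (E : Fin 4 → Matrix X X ℝ) (hQ : S.IsQPolynomial E)
    (hanti : AssocScheme.IsQAntipodal E) (hrel : S.IsQAntipodalRelation E {0, 2}) :
    S.IsTriplyRegular ↔ AssocScheme.aStar E 1 = 0 :=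
  ⟨hrel.aStar_one_eq_zero hQ (by norm_num) (by decide),
    AssocScheme.isTriplyRegular_of_aStar_one_eq_zero hQ.1 hrel (hQ.krein_eq_zero (by decide))⟩
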